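/- Let $a>1$ be real and let $U_0=1$ and $U_n=1+a+\dots+a^{n-1}$ for $n\ge 1$. For every $z\in\mathbb{C}\setminus(-\infty,0]$ the series $$\zeta_U(s,z)=\sum_{n=0}^{\infty}\frac{1}{(z+U_n)^{s}}$$ (powers taken with the principal branch of the logarithm) converges absolutely for $\Re(s)>0$, and $\zeta_U(\cdot,z)$ has a meromorphic continuation to the whole complex $s$-plane. The continuation is holomorphic away from the points $s=-\ell$, $\ell\in\mathbb{N}_0$, and $s=-m+\frac{2\pi i n}{\log a}$, $m\in\mathbb{N}_0$, $n\in\mathbb{Z}\setminus\{0\}$, and its residues at these points are $$\operatorname*{Res}_{s=-\ell}\zeta_U(s,z)=\frac{1}{\log a}\left(z+\frac{1}{1-a}\right)^{\ell},$$ $$\operatorname*{Res}_{s=-m+\frac{2\pi i n}{\log a}}\zeta_U(s,z)=\frac{(a-1)^{\frac{2n\pi i}{\log a}}}{m!\,\log a}\left(z+\frac{1}{1-a}\right)^{m}\prod_{j=1}^{m}\left(j-\frac{2n\pi i}{\log a}\right),$$ with the convention $0^0=1$. If $z\neq\frac{1}{a-1}$, all of these points are simple poles. If $z=\frac{1}{a-1}$,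 those with $\ell=0$ or $m=0$ are simple poles, and the continuation is holomorphic at the others. -/

import Mathlib

/-- The sequence `U₀ = 1`, `Uₙ = 1 + a + ⋯ + a ^ (n - 1)` for `n ≥ 1`. -/
noncomputable def geomPartialSum (a : ℝ) (n : ℕ) : ℝ :=
  if n = 0 then 1 else ∑ j ∈ Finset.range n, a ^ j

/-- `Z` is a meromorphic function on the whole complex plane which, on the half-plane `0 < Re s`,
is the sum of the (convergent) Hurwitz-type Dirichlet series `∑ₙ 1 / (z + Uₙ) ^ s`, where the
powers are taken with the principal branch of the logarithm. -/
def IsHurwitzZetaContinuation (U : ℕ → ℝ) (z : ℂ) (Z : ℂ → ℂ) : Prop :=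
  MeromorphicOn Z Set.univ ∧
    ∀ s : ℂ, 0 < s.re → HasSum (fun n : ℕ => 1 / (z + (U n : ℂ)) ^ s) (Z s)

/-- `f` has a simple pole at `p`. -/
def HasSimplePoleAt (f : ℂ → ℂ) (p : ℂ) : Prop :=
  meromorphicOrderAt f p = -1

/-- `f` is meromorphic at `p` and its residue there is `r`: the integral of `f` over every
sufficiently small positively oriented circle around `p`, divided by `2πi`, equals `r`. -/
def HasResidueAt (f : ℂ → ℂ) (p r : ℂ) : Prop :=
  MeromorphicAt f p ∧
    ∀ᶠ ε : ℝ in nhdsWithin 0 (Set.Ioi 0),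
      (2 * (Real.pi : ℂ) * Complex.I)⁻¹ * (∮ s in C(p, ε), f s) = r

open Filter Topology

/-! ### Simple poles and residues -/

/-! With `w = z + 1 / (1 - a)` and `A = a ^ N / (a - 1)`, all but the first `N` bases are `A a^n +
w`. Choose `N` so large that `|w / A| ≤ 1/2`, expand each `(A a^n + w)^(-s)` binomially in `w`, and
sum over `n` first: the geometric series give the terms `A^(-s) (-s choose k) (w/A)^k / (1 -
a^(-(s+k)))` (`hasSum_geomZeta`, for `Re s > 0`). Their sum over `k` makes sense for all `s` off the
poles: near any point, all but finitely many terms are holomorphic and their tail converges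
uniformly (`exists_geomZeta_eventuallyEq`). The `k`-th term can have poles only on `Re s = -k`,
where they are at most simple, so each pole comes from a single term and its residue is read off
there (`geomZeta_eventuallyEq`). The omitted `N` terms are entire in `s`. If `w = 0`, only `k = 0`
survives. -/

theorem hasResidueAt_of_eventuallyEq {f B : ℂ → ℂ} {p r : ℂ} (hB : AnalyticAt ℂ B p)
    (h : ∀ᶠ s in 𝓝[≠] p, f s = r * (s - p)⁻¹ + B s) : HasResidueAt f p r := by
  have hmer : MeromorphicAt (fun s => r * (s - p)⁻¹ + B s) p := by
    have : MeromorphicAt (fun s : ℂ => s - p) p := by fun_prop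
    exact ((MeromorphicAt.const r p).mul this.inv).add hB.meromorphicAt
  refine ⟨hmer.congr (h.mono fun s hs => hs.symm), ?_⟩
  obtain ⟨δ, hδ, hball⟩ := Metric.eventually_nhds_iff.1
    ((eventually_nhdsWithin_iff.1 h).and hB.eventually_analyticAt)
  filter_upwards [Ioo_mem_nhdsGT hδ] with ε hε
  have hmem : ∀ s ∈ Metric.closedBall p ε, dist s p < δ := fun s hs =>
    (Metric.mem_closedBall.1 hs).trans_lt hε.2
  have hB' : ∀ s ∈ Metric.closedBall p ε, AnalyticAt ℂ B s := fun s hs => (hball (hmem s hs)).2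
  have hBc : ContinuousOn B (Metric.closedBall p ε) := fun s hs =>
    (hB' s hs).continuousAt.continuousWithinAt
  have hB0 : (∮ s in C(p, ε), B s) = 0 :=
    Complex.circleIntegral_eq_zero_of_differentiable_on_off_countable hε.1.le
      Set.countable_empty hBc fun s hs =>
        (hB' s (Metric.ball_subset_closedBall hs.1)).differentiableAt
  have hcongr : (∮ s in C(p, ε), f s) = ∮ s in C(p, ε), (r * (s - p)⁻¹ + B s) := by
    refine circleIntegral.integral_congr hε.1.le fun s hs => ?_
    refine (hball (hmem s (Metric.sphere_subset_closedBall hs))).1 ?_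
    rintro rfl
    simp [hε.1.ne] at hs
  have hi1 : CircleIntegrable (fun s => r * (s - p)⁻¹) p ε := by
    refine ContinuousOn.circleIntegrable hε.1.le (continuousOn_const.mul
      (ContinuousOn.inv₀ (by fun_prop) fun s hs => ?_))
    rw [sub_ne_zero]
    rintro rfl
    simp [hε.1.ne] at hs
  have hi2 : CircleIntegrable B p ε :=
    (hBc.mono Metric.sphere_subset_closedBall).circleIntegrable hε.1.le
  rw [hcongr, circleIntegral.integral_add hi1 hi2, hB0, add_zero,
    circleIntegral.integral_const_mul, circleIntegral.integral_sub_center_inv p hε.1.ne']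
  field_simp [Complex.two_pi_I_ne_zero]

theorem hasSimplePoleAt_of_eventuallyEq {f B : ℂ → ℂ} {p r : ℂ} (hr : r ≠ 0)
    (hB : AnalyticAt ℂ B p) (h : ∀ᶠ s in 𝓝[≠] p, f s = r * (s - p)⁻¹ + B s) :
    HasSimplePoleAt f p := by
  refine (meromorphicOrderAt_eq_int_iff (n := -1) (hasResidueAt_of_eventuallyEq hB h).1).2
    ⟨fun s => r + (s - p) * B s, by fun_prop, by simpa using hr, ?_⟩
  filter_upwards [h, self_mem_nhdsWithin] with s hs hne
  have : s - p ≠ 0 := sub_ne_zero.2 hne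
  rw [hs, zpow_neg_one, smul_eq_mul]
  field_simp

/-- The quotient of `g` by a function with a simple zero at `p`, up to an analytic function. -/
theorem exists_analyticAt_div_eq {g h : ℂ → ℂ} {p d : ℂ} (hg : AnalyticAt ℂ g p)
    (hh : AnalyticAt ℂ h p) (h0 : h p = 0) (hd : HasDerivAt h d p) (hd0 : d ≠ 0) :
    ∃ B : ℂ → ℂ, AnalyticAt ℂ B p ∧
      ∀ᶠ s in 𝓝[≠] p, g s / h s = g p / d * (s - p)⁻¹ + B s := by
  have key : ∀ f : ℂ → ℂ, AnalyticAt ℂ f p → AnalyticAt ℂ (dslope f p) p := by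
    intro f hf
    obtain ⟨P, hP⟩ := hf
    exact ⟨_, hP.has_fpower_series_dslope_fslope⟩
  have hq := key h hh
  have hqp : dslope h p p = d := by rw [dslope_same, hd.deriv]
  -- Dividing out the zero leaves `g / h = Q / (s - p)` with `Q` analytic and `Q p = g p / d`; the
  -- remainder `B` is `dslope Q p`.
  have hQ : AnalyticAt ℂ (fun s => g s / dslope h p s) p := hg.div hq (by rwa [hqp])
  refine ⟨_, key _ hQ, ?_⟩
  filter_upwards [self_mem_nhdsWithin] with s hs
  have hs' : s - p ≠ 0 := sub_ne_zero.2 hs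
  have e1 : h s = (s - p) * dslope h p s := by
    have := sub_smul_dslope h p s
    rw [smul_eq_mul, h0, sub_zero] at this
    exact this.symm
  have e2 := sub_smul_dslope (fun s => g s / dslope h p s) p s
  rw [smul_eq_mul, hqp] at e2
  have e3 : g s / h s = g s / dslope h p s * (s - p)⁻¹ := by
    rw [e1]; field_simp
  rw [e3, ← sub_eq_iff_eq_add', ← sub_mul, ← e2]
  field_simp

/-! ### Binomial coefficients with a negated upper argument -/

/-- The binomial coefficient `(-s choose k)`. -/
noncomputable def negChoose (s : ℂ) (k : ℕ) : ℂ :=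
  (∏ j ∈ Finset.range k, (-s - j)) / k.factorial

/-- The upper bound `R (R + 1) ⋯ (R + k - 1) / k!` for `‖negChoose s k‖` on `‖s‖ ≤ R`. -/
noncomputable def negChooseBound (R : ℝ) (k : ℕ) : ℝ :=
  (∏ j ∈ Finset.range k, (R + j)) / k.factorial

theorem negChoose_eq_choose (s : ℂ) (k : ℕ) : negChoose s k = Ring.choose (-s) k := by
  rw [Ring.choose_eq_smul, negChoose, ← Polynomial.aeval_eq_smeval, smul_eq_mul, div_eq_inv_mul]
  congr 1
  induction k with
  | zero => simp
  | succ k ih => rw [Finset.prod_range_succ, descPochhammer_succ_right, map_mul, ih]; simp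

theorem differentiable_negChoose (k : ℕ) : Differentiable ℂ fun s => negChoose s k := by
  unfold negChoose
  fun_prop

theorem norm_negChoose_le {s : ℂ} {R : ℝ} (hs : ‖s‖ ≤ R) (k : ℕ) :
    ‖negChoose s k‖ ≤ negChooseBound R k := by
  rw [negChoose, negChooseBound, norm_div, norm_prod, Complex.norm_natCast]
  gcongr with j
  calc ‖-s - (j : ℂ)‖ ≤ ‖-s‖ + ‖(j : ℂ)‖ := norm_sub_le _ _
    _ ≤ R + j := by rw [norm_neg, Complex.norm_natCast]; gcongr

theorem negChooseBound_pos {R : ℝ} (hR : 0 < R) (k : ℕ) : 0 < negChooseBound R k := by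
  unfold negChooseBound
  have : ∀ j ∈ Finset.range k, 0 < R + (j : ℝ) := fun j _ => by positivity
  have := Finset.prod_pos this
  positivity

theorem summable_negChooseBound_mul_pow {R r : ℝ} (hR : 0 < R) (hr0 : 0 < r) (hr : r < 1) :
    Summable fun k => negChooseBound R k * r ^ k := by
  have hpos : ∀ k, 0 < negChooseBound R k * r ^ k := fun k =>
    mul_pos (negChooseBound_pos hR k) (pow_pos hr0 k)
  refine summable_of_ratio_test_tendsto_lt_one hr (Eventually.of_forall fun k => (hpos k).ne') ?_
  -- The ratio is `(R + k) / (k + 1) * r`, written so that its limit `r` is visible.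
  have heq : ∀ k : ℕ, ‖negChooseBound R (k + 1) * r ^ (k + 1)‖ / ‖negChooseBound R k * r ^ k‖
      = (1 + (R - 1) * (1 / ((k : ℝ) + 1))) * r := by
    intro k
    rw [Real.norm_of_nonneg (hpos _).le, Real.norm_of_nonneg (hpos _).le,
      div_eq_iff (hpos k).ne']
    simp only [negChooseBound, Finset.prod_range_succ, Nat.factorial_succ, Nat.cast_mul,
      Nat.cast_succ, pow_succ]
    field_simp
    ring
  simp only [heq]
  have := ((tendsto_one_div_add_atTop_nhds_zero_nat (𝕜 := ℝ)).const_mul (R - 1)).const_add 1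
  simpa using this.mul_const r

theorem hasSum_negChoose_mul_pow (s : ℂ) {x : ℂ} (hx : ‖x‖ < 1) :
    HasSum (fun k => negChoose s k * x ^ k) ((1 + x) ^ (-s)) := by
  have h := (Complex.one_add_cpow_hasFPowerSeriesOnBall_zero (a := -s)).hasSum (y := x)
    (by simpa [← ENNReal.ofReal_one, Metric.eball_ofReal] using hx)
  simpa [negChoose_eq_choose, mul_comm, binomialSeries, FormalMultilinearSeries.coeff_ofScalars]
    using h

theorem negChoose_neg_add (m : ℕ) (τ : ℂ) :
    negChoose (-m + τ) m = (∏ j ∈ Finset.Icc 1 m, ((j : ℂ) - τ)) / m.factorial := by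
  rw [negChoose]
  congr 1
  refine Finset.prod_bij' (fun j _ => m - j) (fun j _ => m - j) ?_ ?_ ?_ ?_ ?_
  · intro j hj; rw [Finset.mem_range] at hj; rw [Finset.mem_Icc]; omega
  · intro j hj; rw [Finset.mem_Icc] at hj; rw [Finset.mem_range]; omega
  · intro j hj; rw [Finset.mem_range] at hj; omega
  · intro j hj; rw [Finset.mem_Icc] at hj; omega
  · intro j hj
    rw [Finset.mem_range] at hj
    rw [Nat.cast_sub hj.le]
    ring

/-! ### Dirichlet series over perturbed geometric progressions -/

/-- The `k`-th term of the expansion of `∑ₙ (A * a ^ n + w) ^ (-s)` in powers of `w`. -/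
noncomputable def geomZetaTerm (a A : ℝ) (w : ℂ) (k : ℕ) (s : ℂ) : ℂ :=
  Complex.exp (-s * Real.log A) * negChoose s k * (w / A) ^ k /
    (1 - Complex.exp (-(s + k) * Real.log a))

/-- The continuation of `∑ₙ (A * a ^ n + w) ^ (-s)`. -/
noncomputable def geomZeta (a A : ℝ) (w : ℂ) (s : ℂ) : ℂ :=
  ∑' k, geomZetaTerm a A w k s

section

variable {a A : ℝ} {w : ℂ}

theorem one_sub_exp_eq_zero_iff (ha : 1 < a) (k : ℕ) (s : ℂ) :
    1 - Complex.exp (-(s + k) * Real.log a) = 0 ↔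
      ∃ n : ℤ, s = -(k : ℂ) + 2 * (Real.pi : ℂ) * Complex.I * (n : ℂ) / (Real.log a : ℂ) := by
  have hL : (Real.log a : ℂ) ≠ 0 := by exact_mod_cast (Real.log_pos ha).ne'
  rw [sub_eq_zero, eq_comm, Complex.exp_eq_one_iff]
  constructor
  · rintro ⟨n, hn⟩
    refine ⟨-n, ?_⟩
    field_simp
    push_cast
    linear_combination -hn
  · rintro ⟨n, rfl⟩
    refine ⟨-n, ?_⟩
    field_simp
    push_cast
    ring

theorem differentiable_geomZetaTerm_num (A : ℝ) (w : ℂ) (k : ℕ) :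
    Differentiable ℂ fun s : ℂ =>
      Complex.exp (-s * Real.log A) * negChoose s k * (w / A) ^ k := by
  have := differentiable_negChoose k
  fun_prop

theorem analyticAt_geomZetaTerm {k : ℕ} {s : ℂ}
    (h : 1 - Complex.exp (-(s + k) * Real.log a) ≠ 0) : AnalyticAt ℂ (geomZetaTerm a A w k) s := by
  refine ((differentiable_geomZetaTerm_num A w k).analyticAt s).div ?_ h
  exact Differentiable.analyticAt (by fun_prop) s

theorem geomZetaTerm_zero_eq_zero {k : ℕ} (hk : k ≠ 0) : geomZetaTerm a A 0 k = 0 := by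
  funext s
  simp [geomZetaTerm, hk]

theorem norm_exp_neg_mul_log_le {σ : ℝ} (ha : 1 < a) {s : ℂ} (hs : σ ≤ s.re) :
    ‖Complex.exp (-s * Real.log a)‖ ≤ Real.exp (-σ * Real.log a) := by
  rw [Complex.norm_exp]
  have := (Real.log_pos ha).le
  simp only [neg_mul, Complex.neg_re, Complex.mul_re, Complex.ofReal_re, Complex.ofReal_im,
    mul_zero, sub_zero]
  gcongr

/-- The bound used for uniform convergence of the tail of `geomZeta`. -/
theorem norm_geomZetaTerm_le (ha : 1 < a) (hA : 0 < A) (hw : ‖w‖ ≤ A / 2) {R : ℝ} {k : ℕ} {s : ℂ}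
    (hs : ‖s‖ ≤ R) (hk : R + 1 ≤ k) :
    ‖geomZetaTerm a A w k s‖ ≤
      Real.exp (R * |Real.log A|) / (1 - a⁻¹) * (negChooseBound R k * (1 / 2) ^ k) := by
  have ha' : a⁻¹ < 1 := inv_lt_one_of_one_lt₀ ha
  -- Here `Re (s + k) ≥ k - R ≥ 1`, so the exponential has norm at most `a⁻¹`.
  have hden : 1 - a⁻¹ ≤ ‖1 - Complex.exp (-(s + k) * Real.log a)‖ := by
    have h1 : ‖Complex.exp (-(s + k) * Real.log a)‖ ≤ Real.exp (-1 * Real.log a) := by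
      refine norm_exp_neg_mul_log_le ha ?_
      have := (abs_le.1 (Complex.abs_re_le_norm s)).1
      simp
      linarith
    rw [neg_one_mul, Real.exp_neg, Real.exp_log (by linarith)] at h1
    have h2 := norm_sub_norm_le (1 : ℂ) (Complex.exp (-(s + k) * Real.log a))
    rw [norm_one] at h2
    linarith
  have hexp : ‖Complex.exp (-s * Real.log A)‖ ≤ Real.exp (R * |Real.log A|) := by
    refine (Complex.norm_exp_le_exp_norm _).trans (Real.exp_le_exp.2 ?_)
    rw [norm_mul, norm_neg, Complex.norm_real, Real.norm_eq_abs]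
    gcongr
  have hx : ‖w / A‖ ≤ 1 / 2 := by
    rw [norm_div, Complex.norm_real, Real.norm_of_nonneg hA.le, div_le_iff₀ hA]
    linarith
  have hb : 0 ≤ negChooseBound R k := (norm_nonneg _).trans (norm_negChoose_le hs k)
  rw [geomZetaTerm, norm_div, norm_mul, norm_mul, norm_pow, div_mul_eq_mul_div, ← mul_assoc]
  have := sub_pos.2 ha'
  gcongr
  exact norm_negChoose_le hs k

/-- The poles of the `k`-th term move left with `k`, so a bounded disc meets those of finitely many
terms. Requiring `m < K` keeps the `m`-th term, singled out later, in the finite sum. -/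
theorem exists_geomZeta_eventuallyEq (ha : 1 < a) (hA : 0 < A) (hw : ‖w‖ ≤ A / 2) (p : ℂ)
    (m : ℕ) : ∃ (K : ℕ) (B : ℂ → ℂ), m < K ∧ AnalyticAt ℂ B p ∧
      ∀ᶠ s in 𝓝 p, geomZeta a A w s = B s + ∑ k ∈ Finset.range K, geomZetaTerm a A w k s := by
  set R : ℝ := ‖p‖ + 1 with hR
  have hR0 : 0 < R := by positivity
  obtain ⟨K, hK⟩ := exists_nat_gt (max (R + 1) m)
  have hKR : R + 1 ≤ K := (le_max_left _ _).trans hK.le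
  have hball : Metric.ball (0 : ℂ) R ∈ 𝓝 p := Metric.isOpen_ball.mem_nhds (by simp [hR])
  have hsum : Summable fun k => Real.exp (R * |Real.log A|) / (1 - a⁻¹) *
      (negChooseBound R (k + K) * (1 / 2) ^ (k + K)) :=
    ((summable_nat_add_iff K).2
      (summable_negChooseBound_mul_pow hR0 (by norm_num) (by norm_num))).mul_left _
  have hle : ∀ (k : ℕ) (s : ℂ), s ∈ Metric.ball (0 : ℂ) R → ‖geomZetaTerm a A w (k + K) s‖ ≤
      Real.exp (R * |Real.log A|) / (1 - a⁻¹) *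
        (negChooseBound R (k + K) * (1 / 2) ^ (k + K)) := by
    intro k s hs
    refine norm_geomZetaTerm_le ha hA hw (by simpa using (mem_ball_zero_iff.1 hs).le) ?_
    push_cast
    linarith [Nat.cast_nonneg (α := ℝ) k]
  have hdiff : DifferentiableOn ℂ (fun s => ∑' k, geomZetaTerm a A w (k + K) s)
      (Metric.ball 0 R) := by
    refine Complex.differentiableOn_tsum_of_summable_norm hsum (fun k s hs => ?_)
      Metric.isOpen_ball hle
    refine (analyticAt_geomZetaTerm ?_).differentiableAt.differentiableWithinAt
    rw [Ne, one_sub_exp_eq_zero_iff ha]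
    rintro ⟨n, hn⟩
    have h1 : s.re = -((k + K : ℕ) : ℝ) := by
      have : 2 * (Real.pi : ℂ) * Complex.I * (n : ℂ) / (Real.log a : ℂ)
          = ((2 * Real.pi * n / Real.log a : ℝ) : ℂ) * Complex.I := by
        push_cast; ring
      rw [hn, this]
      simp
    have h2 := (abs_le.1 (Complex.abs_re_le_norm s)).1
    have h3 := mem_ball_zero_iff.1 hs
    push_cast at h1
    linarith [Nat.cast_nonneg (α := ℝ) k]
  refine ⟨K, _, by exact_mod_cast (le_max_right _ _).trans_lt hK, hdiff.analyticAt hball, ?_⟩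
  filter_upwards [hball] with s hs
  have hsm : Summable fun k => geomZetaTerm a A w k s :=
    (summable_nat_add_iff K).1 (Summable.of_norm_bounded hsum fun k => hle k s hs)
  rw [geomZeta, ← hsm.sum_add_tsum_nat_add K, add_comm]

theorem analyticAt_geomZeta (ha : 1 < a) (hA : 0 < A) (hw : ‖w‖ ≤ A / 2) {p : ℂ}
    (h : ∀ k, AnalyticAt ℂ (geomZetaTerm a A w k) p) : AnalyticAt ℂ (geomZeta a A w) p := by
  obtain ⟨K, B, -, hB, hev⟩ := exists_geomZeta_eventuallyEq ha hA hw p 0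
  have hsum : AnalyticAt ℂ (fun s => B s + ∑ k ∈ Finset.range K, geomZetaTerm a A w k s) p :=
    hB.add (Finset.analyticAt_fun_sum _ fun k _ => h k)
  exact hsum.congr (hev.mono fun s hs => hs.symm)

/-- The local expansion of `geomZeta` at a point of the pole lattice. -/
theorem geomZeta_eventuallyEq (ha : 1 < a) (hA : 0 < A) (hw : ‖w‖ ≤ A / 2) (m : ℕ) (n : ℤ)
    {τ : ℂ} (hτ : τ = 2 * (Real.pi : ℂ) * Complex.I * (n : ℂ) / (Real.log a : ℂ)) :
    ∃ B : ℂ → ℂ, AnalyticAt ℂ B (-m + τ) ∧ ∀ᶠ s in 𝓝[≠] (-m + τ), geomZeta a A w s =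
      Complex.exp (-τ * Real.log A) * w ^ m * ((∏ j ∈ Finset.Icc 1 m, ((j : ℂ) - τ)) /
        m.factorial) / Real.log a * (s - (-m + τ))⁻¹ + B s := by
  have hL : (Real.log a : ℂ) ≠ 0 := by exact_mod_cast (Real.log_pos ha).ne'
  have hAc : (A : ℂ) ≠ 0 := by exact_mod_cast hA.ne'
  obtain ⟨K, B, hK, hB, hev⟩ := exists_geomZeta_eventuallyEq ha hA hw (-m + τ) m
  have h0 : 1 - Complex.exp (-(-m + τ + m) * Real.log a) = 0 :=
    (one_sub_exp_eq_zero_iff ha m _).2 ⟨n, by rw [hτ]⟩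
  have hd : HasDerivAt (fun s : ℂ => 1 - Complex.exp (-(s + m) * Real.log a))
      (Real.log a : ℂ) (-m + τ) := by
    have := ((((hasDerivAt_id (-m + τ : ℂ)).add_const (m : ℂ)).neg.mul_const
      (Real.log a : ℂ)).cexp).const_sub 1
    refine this.congr_deriv ?_
    simp only [Pi.neg_apply, id]
    -- The exponential equals `1` at the pole, so the derivative is exactly `log a`.
    rw [← sub_eq_zero.1 h0]
    ring
  obtain ⟨B', hB', hev'⟩ := exists_analyticAt_div_eq
    ((differentiable_geomZetaTerm_num A w m).analyticAt (-m + τ))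
    (Differentiable.analyticAt (by fun_prop) _) h0 hd hL
  refine ⟨fun s => B s + ∑ k ∈ (Finset.range K).erase m, geomZetaTerm a A w k s + B' s,
    (hB.add (Finset.analyticAt_fun_sum _ fun k hk => ?_)).add hB', ?_⟩
  · refine analyticAt_geomZetaTerm ?_
    rw [Ne, one_sub_exp_eq_zero_iff ha]
    -- Comparing real parts, a pole of the `k`-th term here would force `k = m`.
    rintro ⟨n', hn'⟩
    have h1 : ∀ n : ℤ, (2 * (Real.pi : ℂ) * Complex.I * (n : ℂ) / (Real.log a : ℂ)).re = 0 := by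
      intro n
      have : 2 * (Real.pi : ℂ) * Complex.I * (n : ℂ) / (Real.log a : ℂ)
          = ((2 * Real.pi * n / Real.log a : ℝ) : ℂ) * Complex.I := by
        push_cast; ring
      rw [this]
      simp
    have h2 := congrArg Complex.re hn'
    rw [hτ, Complex.add_re, Complex.add_re, h1, h1] at h2
    simp at h2
    exact (Finset.mem_erase.1 hk).1 h2.symm
  · filter_upwards [hev.filter_mono nhdsWithin_le_nhds, hev'] with s hs hs'
    -- The factor `A^m` contained in `A^(-s)` cancels the denominator of `(w/A)^m`.
    have hpow : Complex.exp (-(-m + τ) * Real.log A) * (w / A) ^ m =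
        Complex.exp (-τ * Real.log A) * w ^ m := by
      have : -(-m + τ) * (Real.log A : ℂ) = -τ * Real.log A + m * Real.log A := by ring
      rw [this, Complex.exp_add, Complex.exp_nat_mul, ← Complex.ofReal_exp, Real.exp_log hA,
        div_pow]
      field_simp
    have hsplit := Finset.add_sum_erase (Finset.range K) (fun k => geomZetaTerm a A w k s)
      (Finset.mem_range.2 hK)
    rw [hs, ← hsplit]
    rw [geomZetaTerm, hs', negChoose_neg_add, mul_right_comm _ _ ((w / A) ^ m), hpow]
    ring

/-- Fubini for an absolutely convergent double series: rows are binomial series, columns geometric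
series of ratio `a^(-(s+k))`. -/
theorem hasSum_geomZeta (ha : 1 < a) (hA : 0 < A) (hw : ‖w‖ ≤ A / 2) {s : ℂ} (hs : 0 < s.re) :
    HasSum (fun n : ℕ => 1 / ((A * a ^ n : ℝ) + w) ^ s) (geomZeta a A w s) := by
  have ha0 : 0 < a := by linarith
  have hAc : (A : ℂ) ≠ 0 := by exact_mod_cast hA.ne'
  have hac : (a : ℂ) ≠ 0 := by exact_mod_cast ha0.ne'
  have hx : ‖w / A‖ ≤ 1 / 2 := by
    rw [norm_div, Complex.norm_real, Real.norm_of_nonneg hA.le, div_le_iff₀ hA]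
    linarith
  have hs0 : s ≠ 0 := by rintro rfl; simp at hs
  set E : ℂ := Complex.exp (-s * Real.log A) with hE
  set q : ℂ := Complex.exp (-s * Real.log a) with hq
  have hq1 : ‖q‖ < 1 := by
    refine (norm_exp_neg_mul_log_le ha le_rfl).trans_lt (Real.exp_lt_one_iff.2 ?_)
    have := mul_pos hs (Real.log_pos ha)
    linarith
  have hqk : ∀ k : ℕ, q * (a : ℂ)⁻¹ ^ k = Complex.exp (-(s + k) * Real.log a) := by
    intro k
    have : -(s + k) * (Real.log a : ℂ) = -s * Real.log a - k * Real.log a := by ring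
    rw [this, Complex.exp_sub, Complex.exp_nat_mul, ← Complex.ofReal_exp, Real.exp_log ha0, hq,
      inv_pow, div_eq_mul_inv]
  have hainv : ‖(a : ℂ)⁻¹‖ ≤ 1 := by
    rw [norm_inv, Complex.norm_real, Real.norm_of_nonneg ha0.le]
    exact (inv_lt_one_of_one_lt₀ ha).le
  have hy : ∀ n : ℕ, ‖w / A * (a : ℂ)⁻¹ ^ n‖ ≤ 1 / 2 := fun n => by
    rw [norm_mul, norm_pow]
    exact (mul_le_of_le_one_right (norm_nonneg _) (pow_le_one₀ (norm_nonneg _) hainv)).trans hx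
  -- the double series
  set F : ℕ × ℕ → ℂ := fun i => E * q ^ i.1 * (negChoose s i.2 * (w / A * (a : ℂ)⁻¹ ^ i.1) ^ i.2)
    with hF
  have hFs : Summable F := by
    have h1 : Summable fun i : ℕ × ℕ => ‖q‖ ^ i.1 * (negChooseBound ‖s‖ i.2 * (1 / 2) ^ i.2) :=
      (summable_geometric_of_lt_one (norm_nonneg _) hq1).mul_of_nonneg
        (summable_negChooseBound_mul_pow (norm_pos_iff.2 hs0) (by norm_num) (by norm_num))
        (fun n => by positivity)
        fun k => mul_nonneg (negChooseBound_pos (norm_pos_iff.2 hs0) k).le (by positivity)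
    refine Summable.of_norm_bounded (h1.mul_left ‖E‖) fun ⟨n, k⟩ => ?_
    rw [norm_mul, norm_mul, norm_mul, norm_pow, norm_pow, mul_assoc]
    have hb := (negChooseBound_pos (norm_pos_iff.2 hs0) k).le
    gcongr
    · exact norm_negChoose_le le_rfl k
    · exact hy n
  have hrow : ∀ n : ℕ, HasSum (fun k => F (n, k)) (1 / ((A * a ^ n : ℝ) + w) ^ s) := by
    intro n
    have hy1 := (hy n).trans_lt one_half_lt_one
    set y : ℂ := w / A * (a : ℂ)⁻¹ ^ n with hy
    have hy0 : 1 + y ≠ 0 :=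
      Complex.slitPlane_ne_zero (Complex.mem_slitPlane_of_norm_lt_one hy1)
    have hpos : 0 < A * a ^ n := by positivity
    have hfac : ((A * a ^ n : ℝ) : ℂ) + w = (A * a ^ n : ℝ) * (1 + y) := by
      rw [hy, inv_pow]; push_cast; field_simp
    -- As `A a^n > 0`, the principal logarithm splits with no branch correction.
    have hval : 1 / (((A * a ^ n : ℝ) : ℂ) + w) ^ s = E * q ^ n * (1 + y) ^ (-s) := by
      have hne : ((A * a ^ n : ℝ) : ℂ) ≠ 0 := by exact_mod_cast hpos.ne'
      rw [one_div, ← Complex.cpow_neg, hfac, Complex.cpow_def_of_ne_zero (mul_ne_zero hne hy0),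
        Complex.cpow_def_of_ne_zero hy0, Complex.log_ofReal_mul hpos hy0,
        Real.log_mul hA.ne' (by positivity), Real.log_pow, hE, hq, ← Complex.exp_nat_mul,
        ← Complex.exp_add, ← Complex.exp_add]
      congr 1
      push_cast
      ring
    rw [hval]
    exact (hasSum_negChoose_mul_pow s hy1).mul_left (E * q ^ n)
  have hcol : ∀ k : ℕ, HasSum (fun n => F (n, k)) (geomZetaTerm a A w k s) := by
    intro k
    have hr : ‖q * (a : ℂ)⁻¹ ^ k‖ < 1 := by
      rw [norm_mul, norm_pow]
      calc ‖q‖ * ‖(a : ℂ)⁻¹‖ ^ k ≤ ‖q‖ * 1 := by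
            gcongr
            exact pow_le_one₀ (norm_nonneg _) hainv
        _ < 1 := by rwa [mul_one]
    have := (hasSum_geometric_of_norm_lt_one hr).mul_left (E * negChoose s k * (w / A) ^ k)
    rw [geomZetaTerm, ← hqk, div_eq_mul_inv]
    convert! this using 2 with n
    simp only [hF]
    ring
  obtain ⟨S, hS⟩ := hFs
  clear_value F
  have hS' : HasSum (fun i : ℕ × ℕ => F (i.2, i.1)) S := (Equiv.prodComm ℕ ℕ).hasSum_iff.2 hS
  have h2 : HasSum (fun k => geomZetaTerm a A w k s) S := hS'.prod_fiberwise hcol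
  rw [geomZeta, h2.tsum_eq]
  exact hS.prod_fiberwise hrow

end

/-! ### The Hurwitz-type zeta function of the geometric partial sums -/

theorem geomPartialSum_nonneg {a : ℝ} (ha : 1 < a) (n : ℕ) : 0 ≤ geomPartialSum a n := by
  rw [geomPartialSum]
  split_ifs
  · exact zero_le_one
  · exact Finset.sum_nonneg fun j _ => by positivity

theorem add_geomPartialSum_ne_zero {a : ℝ} (ha : 1 < a) {z : ℂ} (hz : z ∈ Complex.slitPlane)
    (n : ℕ) : z + (geomPartialSum a n : ℂ) ≠ 0 := by
  have hn := geomPartialSum_nonneg ha n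
  intro h
  rw [Complex.mem_slitPlane_iff] at hz
  have h1 := congrArg Complex.re h
  have h2 := congrArg Complex.im h
  simp at h1 h2
  rcases hz with hz | hz
  · linarith
  · exact hz h2

/-- The closed form `(a^n - 1) / (a - 1)` would give `0` at `n = 0`, where the sequence is `1`;
hence `N ≠ 0`. -/
theorem add_geomPartialSum_add {a : ℝ} (ha : 1 < a) (z : ℂ) {N : ℕ} (hN : N ≠ 0) (n : ℕ) :
    z + (geomPartialSum a (n + N) : ℂ) =
      (a ^ N / (a - 1) * a ^ n : ℝ) + (z + 1 / (1 - (a : ℂ))) := by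
  have h1 : (a : ℂ) - 1 ≠ 0 := by exact_mod_cast (sub_pos.2 ha).ne'
  have h2 : 1 - (a : ℂ) ≠ 0 := by rw [← neg_sub]; exact neg_ne_zero.2 h1
  rw [geomPartialSum, if_neg (by omega), geom_sum_eq ha.ne', pow_add]
  push_cast
  have h3 : (1 : ℂ) / (1 - a) = -(1 / (a - 1)) := by rw [← neg_sub, one_div_neg_eq_neg_one_div]
  rw [h3]
  field_simp
  ring

theorem exists_norm_le_pow_div {a : ℝ} (ha : 1 < a) (w : ℂ) :
    ∃ N : ℕ, N ≠ 0 ∧ ‖w‖ ≤ a ^ N / (a - 1) / 2 := by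
  have h := (tendsto_pow_atTop_atTop_of_one_lt ha).eventually_ge_atTop (‖w‖ * 2 * (a - 1))
  obtain ⟨N, hN, hN0⟩ := (h.and (eventually_ne_atTop 0)).exists
  have := sub_pos.2 ha
  exact ⟨N, hN0, by rw [le_div_iff₀ two_pos, le_div_iff₀ this]; exact hN⟩

/-- A finite part of the Dirichlet series together with the continuation of the rest. -/
noncomputable def hurwitzGeomZeta (a : ℝ) (z : ℂ) (N : ℕ) (s : ℂ) : ℂ :=
  geomZeta a (a ^ N / (a - 1)) (z + 1 / (1 - (a : ℂ))) s +
    ∑ n ∈ Finset.range N, 1 / (z + (geomPartialSum a n : ℂ)) ^ s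

theorem analyticAt_sum_one_div_cpow {a : ℝ} (ha : 1 < a) {z : ℂ} (hz : z ∈ Complex.slitPlane)
    (N : ℕ) (p : ℂ) : AnalyticAt ℂ
      (fun s => ∑ n ∈ Finset.range N, 1 / (z + (geomPartialSum a n : ℂ)) ^ s) p := by
  refine Differentiable.analyticAt (Differentiable.fun_sum fun n _ => ?_) p
  have hne := add_geomPartialSum_ne_zero ha hz n
  intro s
  refine (differentiableAt_const _).div (differentiableAt_id.const_cpow (Or.inl hne)) ?_
  simp [Complex.cpow_eq_zero_iff, hne]

/-- The auxiliary `N` drops out of the residues because `a^(-Nτ) = exp(-2πi n N) = 1`. -/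
theorem exp_neg_mul_log_eq_cpow {a : ℝ} (ha : 1 < a) (N : ℕ) {n : ℤ} {τ : ℂ}
    (hτ : τ = 2 * (Real.pi : ℂ) * Complex.I * (n : ℂ) / (Real.log a : ℂ)) :
    Complex.exp (-τ * Real.log (a ^ N / (a - 1))) = ((a : ℂ) - 1) ^ τ := by
  have h1 := sub_pos.2 ha
  have hL : (Real.log a : ℂ) ≠ 0 := by exact_mod_cast (Real.log_pos ha).ne'
  have h2 : (a : ℂ) - 1 ≠ 0 := by exact_mod_cast h1.ne'
  have h3 : Complex.log ((a : ℂ) - 1) = (Real.log (a - 1) : ℂ) := by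
    rw [Complex.ofReal_log h1.le]; push_cast; rfl
  rw [Complex.cpow_def_of_ne_zero h2, h3, Real.log_div (by positivity) h1.ne', Real.log_pow,
    Complex.exp_eq_exp_iff_exists_int]
  refine ⟨-(n * N), ?_⟩
  rw [hτ]
  push_cast
  field_simp
  ring

theorem hurwitzGeomZeta_eventuallyEq {a : ℝ} (ha : 1 < a) {z : ℂ} (hz : z ∈ Complex.slitPlane)
    {N : ℕ} (hN : ‖z + 1 / (1 - (a : ℂ))‖ ≤ a ^ N / (a - 1) / 2) (m : ℕ) (n : ℤ)
    {τ : ℂ} (hτ : τ = 2 * (Real.pi : ℂ) * Complex.I * (n : ℂ) / (Real.log a : ℂ)) :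
    ∃ B : ℂ → ℂ, AnalyticAt ℂ B (-m + τ) ∧
      ∀ᶠ s in 𝓝[≠] (-m + τ), hurwitzGeomZeta a z N s =
        ((a : ℂ) - 1) ^ τ * (z + 1 / (1 - (a : ℂ))) ^ m *
          (∏ j ∈ Finset.Icc 1 m, ((j : ℂ) - τ)) / (m.factorial * Real.log a) *
            (s - (-m + τ))⁻¹ + B s := by
  have hA : 0 < a ^ N / (a - 1) := div_pos (by positivity) (sub_pos.2 ha)
  obtain ⟨B, hB, hev⟩ := geomZeta_eventuallyEq ha hA hN m n hτ
  refine ⟨_, hB.add (analyticAt_sum_one_div_cpow ha hz N _), hev.mono fun s hs => ?_⟩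
  rw [hurwitzGeomZeta, hs, exp_neg_mul_log_eq_cpow ha N hτ, Pi.add_apply, ← add_assoc]
  congr 2
  field_simp

theorem analyticAt_hurwitzGeomZeta {a : ℝ} (ha : 1 < a) {z : ℂ} (hz : z ∈ Complex.slitPlane)
    {N : ℕ} (hN : ‖z + 1 / (1 - (a : ℂ))‖ ≤ a ^ N / (a - 1) / 2) {s : ℂ}
    (hs : ¬ ∃ (m : ℕ) (n : ℤ), (m = 0 ∨ z + 1 / (1 - (a : ℂ)) ≠ 0) ∧
      s = -(m : ℂ) + 2 * (Real.pi : ℂ) * Complex.I * (n : ℂ) / (Real.log a : ℂ)) :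
    AnalyticAt ℂ (hurwitzGeomZeta a z N) s := by
  have hA : 0 < a ^ N / (a - 1) := div_pos (by positivity) (sub_pos.2 ha)
  refine (analyticAt_geomZeta ha hA hN fun k => ?_).add (analyticAt_sum_one_div_cpow ha hz N s)
  by_cases h : k = 0 ∨ z + 1 / (1 - (a : ℂ)) ≠ 0
  · refine analyticAt_geomZetaTerm ?_
    rw [Ne, one_sub_exp_eq_zero_iff ha]
    rintro ⟨n, hn⟩
    exact hs ⟨k, n, h, hn⟩
  · push Not at h
    rw [h.2, geomZetaTerm_zero_eq_zero h.1]
    exact analyticAt_const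

theorem hasSum_hurwitzGeomZeta {a : ℝ} (ha : 1 < a) {z : ℂ} {N : ℕ} (hN0 : N ≠ 0)
    (hN : ‖z + 1 / (1 - (a : ℂ))‖ ≤ a ^ N / (a - 1) / 2) {s : ℂ} (hs : 0 < s.re) :
    HasSum (fun n : ℕ => 1 / (z + (geomPartialSum a n : ℂ)) ^ s) (hurwitzGeomZeta a z N s) := by
  have hA : 0 < a ^ N / (a - 1) := div_pos (by positivity) (sub_pos.2 ha)
  have h := hasSum_geomZeta ha hA hN hs
  simp only [← add_geomPartialSum_add ha z hN0] at h
  exact (hasSum_nat_add_iff (f := fun n : ℕ => 1 / (z + (geomPartialSum a n : ℂ)) ^ s) N).1 h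

theorem add_one_div_one_sub_ne_zero_iff {a : ℝ} (z : ℂ) :
    z + 1 / (1 - (a : ℂ)) ≠ 0 ↔ z ≠ 1 / ((a : ℂ) - 1) := by
  rw [← neg_sub (a : ℂ) 1, one_div_neg_eq_neg_one_div, ← sub_eq_add_neg, sub_ne_zero]

/-- `τ` is purely imaginary, so each factor has real part `j ≥ 1`. -/
theorem prod_natCast_sub_ne_zero {a : ℝ} (m : ℕ) (n : ℤ) {τ : ℂ}
    (hτ : τ = 2 * (Real.pi : ℂ) * Complex.I * (n : ℂ) / (Real.log a : ℂ)) :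
    (∏ j ∈ Finset.Icc 1 m, ((j : ℂ) - τ)) ≠ 0 := by
  refine Finset.prod_ne_zero_iff.2 fun j hj h => ?_
  have h1 : τ = ((2 * Real.pi * n / Real.log a : ℝ) : ℂ) * Complex.I := by
    rw [hτ]; push_cast; ring
  have h2 := congrArg Complex.re h
  rw [h1] at h2
  simp at h2
  have := (Finset.mem_Icc.1 hj).1
  omega

theorem mainTheorem4 (a : ℝ) (ha : 1 < a) (z : ℂ) (hz : z ∈ Complex.slitPlane) :
    ∃ Z : ℂ → ℂ,
      IsHurwitzZetaContinuation (geomPartialSum a) z Z ∧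
      -- residues at the non-positive integers
      (∀ l : ℕ,
        HasResidueAt Z (-(l : ℂ)) ((z + 1 / (1 - (a : ℂ))) ^ l / (Real.log a : ℂ))) ∧
      -- residues at the non-real points
      (∀ (m : ℕ) (n : ℤ), n ≠ 0 →
        HasResidueAt Z
          (-(m : ℂ) + 2 * (Real.pi : ℂ) * Complex.I * (n : ℂ) / (Real.log a : ℂ))
          (((a : ℂ) - 1) ^ (2 * (n : ℂ) * (Real.pi : ℂ) * Complex.I / (Real.log a : ℂ)) *
              (z + 1 / (1 - (a : ℂ))) ^ m *
              (∏ j ∈ Finset.Icc 1 m,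
                ((j : ℂ) - 2 * (n : ℂ) * (Real.pi : ℂ) * Complex.I / (Real.log a : ℂ))) /
            ((m.factorial : ℂ) * (Real.log a : ℂ)))) ∧
      -- all these points are simple poles, except that for `z = 1 / (a - 1)` only those on the
      -- imaginary axis are
      (∀ l : ℕ, l = 0 ∨ z ≠ 1 / ((a : ℂ) - 1) → HasSimplePoleAt Z (-(l : ℂ))) ∧
      (∀ (m : ℕ) (n : ℤ), n ≠ 0 → m = 0 ∨ z ≠ 1 / ((a : ℂ) - 1) →
        HasSimplePoleAt Z
          (-(m : ℂ) + 2 * (Real.pi : ℂ) * Complex.I * (n : ℂ) / (Real.log a : ℂ))) ∧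
      -- there are no other poles
      (∀ s : ℂ,
        (¬ ∃ (m : ℕ) (n : ℤ), (m = 0 ∨ z ≠ 1 / ((a : ℂ) - 1)) ∧
          s = -(m : ℂ) + 2 * (Real.pi : ℂ) * Complex.I * (n : ℂ) / (Real.log a : ℂ)) →
        AnalyticAt ℂ Z s) := by
  set w : ℂ := z + 1 / (1 - (a : ℂ)) with hw
  have hL : (Real.log a : ℂ) ≠ 0 := by exact_mod_cast (Real.log_pos ha).ne'
  have ha1 : (a : ℂ) - 1 ≠ 0 := by exact_mod_cast (sub_pos.2 ha).ne'
  have hwz : w ≠ 0 ↔ z ≠ 1 / ((a : ℂ) - 1) := add_one_div_one_sub_ne_zero_iff z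
  obtain ⟨N, hN0, hN⟩ := exists_norm_le_pow_div ha w
  have hτ' : ∀ n : ℤ, 2 * (n : ℂ) * (Real.pi : ℂ) * Complex.I / (Real.log a : ℂ) =
      2 * (Real.pi : ℂ) * Complex.I * (n : ℂ) / (Real.log a : ℂ) := fun n => by ring
  have hres : ∀ (m : ℕ) (n : ℤ), HasResidueAt (hurwitzGeomZeta a z N)
      (-(m : ℂ) + 2 * (Real.pi : ℂ) * Complex.I * (n : ℂ) / (Real.log a : ℂ))
      (((a : ℂ) - 1) ^ (2 * (n : ℂ) * (Real.pi : ℂ) * Complex.I / (Real.log a : ℂ)) * w ^ m *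
        (∏ j ∈ Finset.Icc 1 m,
          ((j : ℂ) - 2 * (n : ℂ) * (Real.pi : ℂ) * Complex.I / (Real.log a : ℂ))) /
        ((m.factorial : ℂ) * (Real.log a : ℂ))) := by
    intro m n
    obtain ⟨B, hB, hev⟩ := hurwitzGeomZeta_eventuallyEq ha hz hN m n rfl
    rw [hτ']
    exact hasResidueAt_of_eventuallyEq hB hev
  have hpole : ∀ (m : ℕ) (n : ℤ), m = 0 ∨ z ≠ 1 / ((a : ℂ) - 1) →
      HasSimplePoleAt (hurwitzGeomZeta a z N)
        (-(m : ℂ) + 2 * (Real.pi : ℂ) * Complex.I * (n : ℂ) / (Real.log a : ℂ)) := by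
    intro m n hmz
    obtain ⟨B, hB, hev⟩ := hurwitzGeomZeta_eventuallyEq ha hz hN m n rfl
    refine hasSimplePoleAt_of_eventuallyEq (div_ne_zero (mul_ne_zero (mul_ne_zero ?_ ?_)
      (prod_natCast_sub_ne_zero m n rfl))
      (mul_ne_zero (Nat.cast_ne_zero.2 m.factorial_ne_zero) hL)) hB hev
    · simp [Complex.cpow_eq_zero_iff, ha1]
    · rcases hmz with rfl | h
      · simp
      · exact pow_ne_zero _ (hwz.2 h)
  have hana : ∀ s : ℂ, (¬ ∃ (m : ℕ) (n : ℤ), (m = 0 ∨ z ≠ 1 / ((a : ℂ) - 1)) ∧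
      s = -(m : ℂ) + 2 * (Real.pi : ℂ) * Complex.I * (n : ℂ) / (Real.log a : ℂ)) →
        AnalyticAt ℂ (hurwitzGeomZeta a z N) s := by
    intro s hs
    rw [← hwz] at hs
    exact analyticAt_hurwitzGeomZeta ha hz hN hs
  refine ⟨hurwitzGeomZeta a z N, ⟨fun s _ => ?_, fun s hs => hasSum_hurwitzGeomZeta ha hN0 hN hs⟩,
    fun l => ?_, fun m n _ => hres m n, fun l hl => ?_, fun m n _ hmz => hpole m n hmz, hana⟩
  · by_cases h : ∃ (m : ℕ) (n : ℤ), (m = 0 ∨ z ≠ 1 / ((a : ℂ) - 1)) ∧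
        s = -(m : ℂ) + 2 * (Real.pi : ℂ) * Complex.I * (n : ℂ) / (Real.log a : ℂ)
    · obtain ⟨m, n, -, rfl⟩ := h
      exact (hres m n).1
    · exact (hana s h).meromorphicAt
  · have hfac : (∏ j ∈ Finset.Icc 1 l, (j : ℂ)) = l.factorial := by
      induction l with
      | zero => simp
      | succ l ih => rw [Finset.prod_Icc_succ_top (by omega), ih, Nat.factorial_succ]; push_cast; ring
    -- At `n = 0` the product is `l!`, which cancels the factorial in the denominator.
    have h := hres l 0
    have hl0 : (l.factorial : ℂ) ≠ 0 := Nat.cast_ne_zero.2 l.factorial_ne_zero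
    simp only [Int.cast_zero, mul_zero, zero_mul, zero_div, add_zero, sub_zero, Complex.cpow_zero,
      one_mul, hfac] at h
    convert h using 1
    field_simp
  · simpa using hpole l 0 hl
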